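/- Let $X$ be a compact Hausdorff space with no converging $\omega_1$-sequences; that is, there do not exist an injective sequence $\langle x_\alpha:\alpha<\omega_1\rangle$ of points of $X$ and a point $x\in X$ such that for every neighbourhood $U$ of $x$ there is an $\alpha<\omega_1$ with $x_\beta\in U$ for all $\beta$ with $\alpha\le\beta<\omega_1$. If every separable subspace of $X$ is first-countable, then $X$ itself is first-countable. -/

import Mathlib

open Set Filter Topology Ordinal

/-- A topological space is `ω₁`-free if it has no converging `ω₁`-sequence, where sequences are
injective: there is no injective family `⟨s α : α < ω₁⟩` of points of `X` together with a
point `x` such that every neighbourhood of `x` contains a tail of the family. -/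
def OmegaOneFree (X : Type*) [TopologicalSpace X] : Prop :=
  ¬ ∃ (s : Set.Iio (ω₁ : Ordinal.{0}) → X) (x : X), Function.Injective s ∧
    ∀ U ∈ 𝓝 x, ∃ α, ∀ β, α ≤ β → s β ∈ U

/-! If `x` is not a point of first countability, compactness shows that `{x}` is not a Gδ. For
countable `A`, first countability of the closure of `A ∪ {x}` gives a closed Gδ `Z A ∋ x` meeting
the closure of `A` in at most `x`. Recursion yields points `s α ≠ x` in every `Z` of an initial
segment up to `α`. If the union `T` of the closures of initial segments is closed, compactness
forces `s` to converge to `x`, a contradiction.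

Closedness of `T` is `OmegaOneFree.isClosed_of_closure_countable_subset`: failure would produce a
free `ω₁`-sequence. By a case of Šapirovskii's theorem, the set `F` of its complete accumulation
points has a point `p` of countable π-character in `F`. Ultrafilter limits along a local π-base at
`p` then form an `ω₁`-sequence converging to `p`. -/

/-- The well-ordered type of all countable ordinals. -/
abbrev CountableOrdinal : Type 1 := Set.Iio (ω₁ : Ordinal.{0})

/-! ### Countable ordinals, recursion and pressing down -/

namespace CountableOrdinal

theorem countable_Iio (α : CountableOrdinal) : (Set.Iio α).Countable := by
  have h : (Set.Iio α.1).Countable := by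
    rw [← Cardinal.le_aleph0_iff_set_countable, Cardinal.mk_Iio_ordinal,
      ← Cardinal.lift_aleph0.{1, 0}, Cardinal.lift_le]
    have := Cardinal.lt_ord.1 (lt_of_lt_of_eq α.2 (Cardinal.ord_aleph 1).symm)
    rw [← Cardinal.succ_aleph0] at this
    exact Order.lt_succ_iff.1 this
  exact (h.preimage Subtype.val_injective).mono fun β hβ => hβ

theorem exists_gt {A : Set CountableOrdinal} (hA : A.Countable) : ∃ γ, ∀ α ∈ A, α < γ := by
  have := hA.to_subtype
  have h : (⨆ a : A, Order.succ (a : CountableOrdinal).1) < (ω₁ : Ordinal.{0}) := by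
    refine Ordinal.iSup_lt_omega_one fun a => ?_
    exact (Cardinal.isSuccLimit_omega 1).succ_lt a.1.2
  refine ⟨⟨_, h⟩, fun α hα => ?_⟩
  have := Ordinal.le_iSup (fun a : A => Order.succ (a : CountableOrdinal).1) ⟨α, hα⟩
  exact Subtype.mk_lt_mk.2 ((Order.lt_succ _).trans_le this)

theorem countable_Iic (α : CountableOrdinal) : (Set.Iic α).Countable := by
  obtain ⟨γ, hγ⟩ := exists_gt (countable_singleton α)
  exact (countable_Iio γ).mono fun β hβ => lt_of_le_of_lt hβ (hγ α rfl)

instance : Nonempty CountableOrdinal := ⟨(exists_gt countable_empty).choose⟩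

theorem exists_injective_real : ∃ j : CountableOrdinal → ℝ, Function.Injective j := by
  have h : Cardinal.lift.{0} (Cardinal.mk CountableOrdinal) ≤ Cardinal.lift.{1} (Cardinal.mk ℝ) := by
    rw [Cardinal.mk_real, Cardinal.mk_Iio_ordinal]
    simpa using Cardinal.aleph_one_le_continuum
  obtain ⟨e⟩ := Cardinal.lift_mk_le'.1 h
  exact ⟨e, e.injective⟩

/-- Definition by recursion along the countable ordinals, with choice at every step. -/
theorem exists_recursive_sequence {Y : Type*}
    (R : ∀ α : CountableOrdinal, (∀ β, β < α → Y) → Y → Prop) (h : ∀ α f, ∃ y, R α f y) :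
    ∃ x : CountableOrdinal → Y, ∀ α, R α (fun β _ => x β) (x α) := by
  choose g hg using h
  have wf : WellFounded (fun a b : CountableOrdinal => a < b) := wellFounded_lt
  refine ⟨wf.fix g, fun α => ?_⟩
  have := hg α (fun β _ => wf.fix g β)
  rwa [← wf.fix_eq g] at this

/-- A form of the pressing down lemma for finite sets. -/
theorem exists_unbounded_fiber {Z : Type*} {𝓢 : CountableOrdinal → Set Z}
    (hcount : ∀ α, (𝓢 α).Countable)
    (hlim : ∀ α, ∀ z ∈ 𝓢 α, ∃ β < α, ∀ γ, β < γ → z ∈ 𝓢 γ)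
    (s : CountableOrdinal → Set Z) (hfin : ∀ α, (s α).Finite) (hs : ∀ α, s α ⊆ 𝓢 α) :
    ∃ t : Set Z, ∀ γ, ∃ α, γ ≤ α ∧ s α = t := by
  by_contra! hcon
  choose h hh using hcon
  have hg : ∀ γ, ∃ γ', γ < γ' ∧ ∀ t : Set Z, t.Finite → t ⊆ 𝓢 γ → h t < γ' := by
    intro γ
    obtain ⟨γ', hγ'⟩ := exists_gt
      (((countable_ofPred_finite_subset (hcount γ)).image h).insert γ)
    exact ⟨γ', hγ' _ (mem_insert _ _), fun t ht hts =>
      hγ' _ (mem_insert_of_mem _ (mem_image_of_mem h ⟨ht, hts⟩))⟩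
  choose g hg₁ hg₂ using hg
  let c : ℕ → CountableOrdinal := fun n => g^[n] (Classical.arbitrary _)
  have hc : ∀ n, c (n + 1) = g (c n) := fun n => Function.iterate_succ_apply' _ _ _
  have hmono : StrictMono c := strictMono_nat_of_lt_succ fun n => by rw [hc]; exact hg₁ _
  have hne : {δ | ∀ n, c n < δ}.Nonempty := by
    obtain ⟨δ, hδ⟩ := exists_gt (countable_range c)
    exact ⟨δ, fun n => hδ _ (mem_range_self n)⟩
  -- `δ` is the supremum of the `c n`, so the finite set `s δ` already lies in some `𝓢 (c n)`;
  -- closing off under `g` puts its bound below `δ`.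
  obtain ⟨δ, hδ, hmin⟩ := WellFounded.has_min (wellFounded_lt (α := CountableOrdinal)) _ hne
  have hz : ∀ z ∈ s δ, ∃ n, ∀ m ≥ n, z ∈ 𝓢 (c m) := by
    intro z hz
    obtain ⟨β, hβ, hβ'⟩ := hlim δ z (hs δ hz)
    have : ¬ ∀ n, c n < β := fun hcon => hmin β hcon hβ
    push Not at this
    obtain ⟨n, hn⟩ := this
    exact ⟨n + 1, fun m hm => hβ' _ (hn.trans_lt (hmono hm))⟩
  choose! N hN using hz
  obtain ⟨n, hn⟩ := ((hfin δ).image N).bddAbove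
  have hsub : s δ ⊆ 𝓢 (c n) := fun z hz => hN z hz n (hn (mem_image_of_mem N hz))
  have h₁ := hg₂ (c n) (s δ) (hfin δ) hsub
  rw [← hc] at h₁
  exact hh (s δ) δ (h₁.trans (hδ _)).le rfl

end CountableOrdinal

open CountableOrdinal

/-- A family of points different from `p` that converges to `p` along the countable ordinals has
an injective subfamily. -/
theorem not_omegaOneFree_of_tendsto {X : Type*} [TopologicalSpace X] [T1Space X]
    {s : CountableOrdinal → X} {p : X} (hne : ∀ α, s α ≠ p)
    (hs : ∀ U ∈ 𝓝 p, ∃ α, ∀ β, α ≤ β → s β ∈ U) : ¬ OmegaOneFree X := by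
  choose g hg using fun α => hs _ (isOpen_compl_singleton.mem_nhds (hne α).symm)
  obtain ⟨t, ht⟩ := exists_recursive_sequence
    (fun α (f : ∀ β, β < α → CountableOrdinal) y => ∀ β h, f β h < y ∧ g (f β h) < y) (by
      intro α f
      have := (countable_Iio α).to_subtype
      obtain ⟨γ, hγ⟩ := exists_gt ((countable_range fun b : Set.Iio α => f b b.2).union
        (countable_range fun b : Set.Iio α => g (f b b.2)))
      exact ⟨γ, fun β h => ⟨hγ _ (.inl ⟨⟨β, h⟩, rfl⟩), hγ _ (.inr ⟨⟨β, h⟩, rfl⟩)⟩⟩)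
  have hmono : StrictMono t := fun β α h => (ht α β h).1
  rw [OmegaOneFree, not_not]
  refine ⟨s ∘ t, p, ?_, fun U hU => ?_⟩
  · have key : ∀ β α, β < α → s (t β) ≠ s (t α) := fun β α h heq =>
      hg (t β) (t α) (ht α β h).2.le heq.symm
    intro α β hαβ
    rcases lt_trichotomy α β with h | h | h
    · exact (key _ _ h hαβ).elim
    · exact h
    · exact (key _ _ h hαβ.symm).elim
  · obtain ⟨α, hα⟩ := hs U hU
    exact ⟨α, fun β hβ => hα _ (hβ.trans hmono.le_apply)⟩

/-! ### Countable closures and Gδ sets -/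

theorem Set.Countable.separableSpace_closure {X : Type*} [TopologicalSpace X] {A : Set X}
    (hA : A.Countable) : TopologicalSpace.SeparableSpace (closure A) := by
  have := hA.to_subtype
  refine .of_denseRange (Set.inclusion (subset_closure (s := A))) fun x => ?_
  rw [closure_subtype, ← range_comp]
  have : Subtype.val ∘ Set.inclusion (subset_closure (s := A)) = Subtype.val := rfl
  rw [this, Subtype.range_coe]
  exact x.2

/-- A point of a `Gδ` set of a regular space is surrounded by a shrinking sequence of closed
neighbourhoods whose intersection is contained in the set. -/
theorem IsGδ.exists_closed_nhds_seq {X : Type*} [TopologicalSpace X] [RegularSpace X]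
    {G : Set X} (hG : IsGδ G) {y : X} (hy : y ∈ G) :
    ∃ C : ℕ → Set X, (∀ n, IsClosed (C n)) ∧ (∀ n, C n ∈ 𝓝 y) ∧
      (∀ n, C (n + 1) ⊆ interior (C n)) ∧ ⋂ n, C n ⊆ G := by
  obtain ⟨U, hU, rfl⟩ := isGδ_iff_eq_iInter_nat.1 hG
  have hyU : ∀ n, U n ∈ 𝓝 y := fun n => (hU n).mem_nhds (mem_iInter.1 hy n)
  have step : ∀ (n : ℕ) (D : {D : Set X // D ∈ 𝓝 y ∧ IsClosed D}),
      ∃ E : {D : Set X // D ∈ 𝓝 y ∧ IsClosed D}, E.1 ⊆ interior D.1 ∩ U n := by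
    intro n D
    obtain ⟨E, hE, hE', hEs⟩ := exists_mem_nhds_isClosed_subset
      (inter_mem (interior_mem_nhds.2 D.2.1) (hyU n))
    exact ⟨⟨E, hE, hE'⟩, hEs⟩
  choose g hg using step
  let C : ℕ → {D : Set X // D ∈ 𝓝 y ∧ IsClosed D} :=
    fun n => Nat.rec ⟨univ, univ_mem, isClosed_univ⟩ g n
  refine ⟨fun n => (C n).1, fun n => (C n).2.2, fun n => (C n).2.1,
    fun n => (hg n (C n)).trans inter_subset_left, fun z hz => mem_iInter.2 fun n => ?_⟩
  exact (hg n (C n) (mem_iInter.1 hz (n + 1))).2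

theorem IsGδ.exists_isClosed_isGδ_subset {X : Type*} [TopologicalSpace X] [RegularSpace X]
    {G : Set X} (hG : IsGδ G) {y : X} (hy : y ∈ G) :
    ∃ Z ⊆ G, IsClosed Z ∧ IsGδ Z ∧ y ∈ Z := by
  obtain ⟨C, hC, hCy, hCi, hCG⟩ := hG.exists_closed_nhds_seq hy
  refine ⟨⋂ n, C n, hCG, isClosed_iInter hC, ?_, mem_iInter.2 fun n => mem_of_mem_nhds (hCy n)⟩
  have : ⋂ n, C n = ⋂ n, interior (C n) :=
    subset_antisymm (subset_iInter fun n => (iInter_subset _ (n + 1)).trans (hCi n))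
      (iInter_mono fun n => interior_subset)
  rw [this]
  exact .iInter_of_isOpen fun n => isOpen_interior

/-- By compactness, shrinking closed neighbourhoods with intersection `{x}` form a base at `x`. -/
theorem IsGδ.isCountablyGenerated_nhds {X : Type*} [TopologicalSpace X] [CompactSpace X]
    [T2Space X] {x : X} (hx : IsGδ {x}) : (𝓝 x).IsCountablyGenerated := by
  obtain ⟨C, hC, hCx, hCi, hCG⟩ := hx.exists_closed_nhds_seq (mem_singleton x)
  have hanti : Antitone C := antitone_nat_of_succ_le fun n => (hCi n).trans interior_subset
  have hb : (𝓝 x).HasBasis (fun _ : ℕ => True) C := by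
    refine ⟨fun U => ⟨fun hU => ?_, fun ⟨n, _, hn⟩ => mem_of_superset (hCx n) hn⟩⟩
    obtain ⟨n, hn⟩ := exists_subset_nhds_of_compactSpace hanti.directed_ge hC (U := U)
      fun z hz => by rw [mem_singleton_iff.1 (hCG hz)]; exact hU
    exact ⟨n, trivial, hn⟩
  exact HasCountableBasis.isCountablyGenerated ⟨hb, to_countable _⟩

/-- If a set contains the closures of its countable subsets then each `Gδ` set around a point of
its closure meets it. -/
theorem IsGδ.inter_nonempty_of_mem_closure {X : Type*} [TopologicalSpace X] [CompactSpace X]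
    [T2Space X] {T : Set X} (hT : ∀ A ⊆ T, A.Countable → closure A ⊆ T) {y : X}
    (hy : y ∈ closure T) {G : Set X} (hG : IsGδ G) (hyG : y ∈ G) : (G ∩ T).Nonempty := by
  obtain ⟨C, hC, hCy, hCi, hCG⟩ := hG.exists_closed_nhds_seq hyG
  have hanti : Antitone C := antitone_nat_of_succ_le fun n => (hCi n).trans interior_subset
  choose t ht using fun n => mem_closure_iff_nhds.1 hy _ (hCy n)
  obtain ⟨z, -, hz⟩ := isCompact_univ.exists_mapClusterPt (f := atTop) (u := t) (by simp)
  rw [mapClusterPt_atTop_iff_forall_mem_closure] at hz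
  refine ⟨z, hCG (mem_iInter.2 fun n => ?_), hT (range t) (range_subset_iff.2 fun n => (ht n).2)
    (countable_range t) (closure_mono (image_subset_range _ _) (hz 0))⟩
  have hsub : t '' Ici n ⊆ C n := by
    rintro _ ⟨m, hm, rfl⟩
    exact hanti hm (ht m).1
  exact closure_minimal hsub (hC n) (hz n)

/-! ### Countable π-character -/

/-- The point `p` has a countable local `π`-base. -/
def HasCountablePiBaseAt {Y : Type*} [TopologicalSpace Y] (p : Y) : Prop :=
  ∃ 𝓑 : Set (Set Y), 𝓑.Countable ∧ (∀ B ∈ 𝓑, IsOpen B ∧ B.Nonempty) ∧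
    ∀ U ∈ 𝓝 p, ∃ B ∈ 𝓑, B ⊆ U

/-- Without points of countable `π`-character, every countable family of open sets admits
a pair of open sets with disjoint closures that splits all nonempty finite intersections
of the family below some nonempty finite intersection. -/
theorem exists_splitting_pair {Y : Type*} [TopologicalSpace Y] [CompactSpace Y] [T2Space Y]
    [Nonempty Y] (hno : ∀ p : Y, ¬ HasCountablePiBaseAt p) {𝓢 : Set (Set Y)}
    (hc : 𝓢.Countable) (ho : ∀ B ∈ 𝓢, IsOpen B) :
    ∃ Q : Bool → Set Y, (∀ ε, IsOpen (Q ε)) ∧ Disjoint (closure (Q false)) (closure (Q true)) ∧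
      ∃ s ⊆ 𝓢, s.Finite ∧ (⋂₀ s).Nonempty ∧
        ∀ t ⊆ 𝓢, t.Finite → s ⊆ t → (⋂₀ t).Nonempty → ∀ ε, (⋂₀ t ∩ Q ε).Nonempty := by
  classical
  let 𝓣 : Set (Set (Set Y)) := {t | (t.Finite ∧ t ⊆ 𝓢) ∧ (⋂₀ t).Nonempty}
  have h𝓣c : 𝓣.Countable := (countable_ofPred_finite_subset hc).mono fun t ht => ht.1
  have h𝓣o : ∀ t ∈ 𝓣, IsOpen (⋂₀ t) := fun t ht => ht.1.1.isOpen_sInter fun B hB => ho B (ht.1.2 hB)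
  have hpair : ∀ p : Y, ∃ V W : Set Y, IsOpen V ∧ IsOpen W ∧ p ∈ V ∧
      Disjoint (closure V) (closure W) ∧ ∀ t ∈ 𝓣, (⋂₀ t ∩ W).Nonempty := by
    intro p
    have hp := hno p
    rw [HasCountablePiBaseAt] at hp
    push Not at hp
    obtain ⟨U, hU, hUB⟩ := hp (sInter '' 𝓣) (h𝓣c.image _) (by
      rintro _ ⟨t, ht, rfl⟩
      exact ⟨h𝓣o t ht, ht.2⟩)
    obtain ⟨C, hC, hCc, hCU⟩ := exists_mem_nhds_isClosed_subset hU
    obtain ⟨D, hD, hDc, hDC⟩ := exists_mem_nhds_isClosed_subset (interior_mem_nhds.2 hC)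
    refine ⟨interior D, Cᶜ, isOpen_interior, hCc.isOpen_compl, mem_interior_iff_mem_nhds.2 hD,
      ?_, fun t ht => ?_⟩
    · rw [closure_compl]
      exact disjoint_compl_right.mono_left
        ((closure_minimal interior_subset hDc).trans hDC)
    · obtain ⟨y, hy, hyU⟩ := not_subset.1 (hUB _ (mem_image_of_mem _ ht))
      exact ⟨y, hy, fun h => hyU (hCU h)⟩
  choose V W hV hW hpV hVW hWt using hpair
  obtain ⟨q, hq⟩ := isCompact_univ.elim_finite_subcover V hV fun p _ => mem_iUnion.2 ⟨p, hpV p⟩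
  -- A choice of `s` meeting as few cover members as possible makes `I` constant on extensions of
  -- `s`: a `V p` met by `⋂₀ s` stays met.
  let I : Set (Set Y) → Finset Y := fun t => q.filter fun p => (⋂₀ t ∩ V p).Nonempty
  have hne : 𝓣.Nonempty := ⟨∅, ⟨finite_empty, empty_subset _⟩, by simp⟩
  obtain ⟨s, hs, hmin⟩ := (InvImage.wf (fun t => (I t).card) wellFounded_lt).has_min 𝓣 hne
  obtain ⟨y, hy⟩ := hs.2
  obtain ⟨p, hpq, hyp⟩ := mem_iUnion₂.1 (hq (mem_univ y))
  refine ⟨fun ε => bif ε then W p else V p, ?_, hVW p, s, hs.1.2, hs.1.1, hs.2, ?_⟩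
  · rintro (_ | _)
    exacts [hV p, hW p]
  · intro t ht htf hst htne
    have htT : t ∈ 𝓣 := ⟨⟨htf, ht⟩, htne⟩
    rintro (_ | _)
    · have hsub : I t ⊆ I s := Finset.monotone_filter_right _ fun r _ hr =>
        hr.mono (inter_subset_inter_left _ (sInter_subset_sInter hst))
      have heq : I t = I s := Finset.eq_of_subset_of_card_le hsub (not_lt.1 (hmin t htT))
      have : p ∈ I t := heq ▸ Finset.mem_filter.2 ⟨hpq, y, hy, hyp⟩
      exact (Finset.mem_filter.1 this).2
    · exact hWt p t htT

/-- An uncountable dyadic system in a compact space all of whose points have uncountable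
`π`-character. -/
theorem exists_dyadic_system {Y : Type*} [TopologicalSpace Y] [CompactSpace Y] [T2Space Y]
    [Nonempty Y] (hno : ∀ p : Y, ¬ HasCountablePiBaseAt p) :
    ∃ (Q : CountableOrdinal → Bool → Set Y) (S : Set CountableOrdinal),
      (∀ γ, ∃ α ∈ S, γ ≤ α) ∧ (∀ α, Disjoint (closure (Q α false)) (closure (Q α true))) ∧
      ∀ (u : Finset CountableOrdinal) (ε : CountableOrdinal → Bool), ↑u ⊆ S →
        (⋂ α ∈ u, Q α (ε α)).Nonempty := by
  classical
  let P := {Q : Bool → Set Y // ∀ ε, IsOpen (Q ε)}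
  let R : Set (Set Y) → (Bool → Set Y) → Prop := fun 𝓢 Q =>
    Disjoint (closure (Q false)) (closure (Q true)) ∧
      ∃ s ⊆ 𝓢, s.Finite ∧ (⋂₀ s).Nonempty ∧
        ∀ t ⊆ 𝓢, t.Finite → s ⊆ t → (⋂₀ t).Nonempty → ∀ ε, (⋂₀ t ∩ Q ε).Nonempty
  obtain ⟨Q, hQ⟩ := exists_recursive_sequence (Y := P)
    (fun α f Q => R {B | ∃ β, ∃ h : β < α, ∃ ε, (f β h).1 ε = B} Q.1) (by
      intro α f
      have := (countable_Iio α).to_subtype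
      obtain ⟨Q, hQo, hQ⟩ := exists_splitting_pair hno
        (𝓢 := {B | ∃ β, ∃ h : β < α, ∃ ε, (f β h).1 ε = B})
        ((countable_range fun b : Set.Iio α × Bool => (f b.1 b.1.2).1 b.2).mono (by
          rintro _ ⟨β, h, ε, rfl⟩
          exact ⟨(⟨β, h⟩, ε), rfl⟩))
        (by rintro _ ⟨β, h, ε, rfl⟩; exact (f β h).2 ε)
      exact ⟨⟨Q, hQo⟩, hQ⟩)
  let 𝓢 : CountableOrdinal → Set (Set Y) := fun α => {B | ∃ β < α, ∃ ε, (Q β).1 ε = B}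
  have hQ' : ∀ α, R (𝓢 α) (Q α).1 := fun α => by
    convert hQ α using 1
    ext B
    simp [𝓢]
  choose hdisj s hs hsf hsne hst using hQ'
  obtain ⟨t, ht⟩ := exists_unbounded_fiber (𝓢 := 𝓢)
    (fun α => by
      have := (countable_Iio α).to_subtype
      refine (countable_range fun b : Set.Iio α × Bool => (Q b.1).1 b.2).mono ?_
      rintro _ ⟨β, h, ε, rfl⟩
      exact ⟨(⟨β, h⟩, ε), rfl⟩)
    (by
      rintro α _ ⟨β, h, ε, rfl⟩
      exact ⟨β, h, fun γ hγ => ⟨β, hγ, ε, rfl⟩⟩) s hsf hs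
  refine ⟨fun α => (Q α).1, {α | s α = t}, fun γ => ?_, hdisj, fun u ε hu => ?_⟩
  · obtain ⟨α, h₁, h₂⟩ := ht γ
    exact ⟨α, h₂, h₁⟩
  -- Keeping the common root `t` in the intersection is what lets the splitting property of the
  -- largest index apply.
  suffices (⋂₀ t ∩ ⋂ α ∈ u, (Q α).1 (ε α)).Nonempty from this.mono inter_subset_right
  induction u using Finset.induction_on_max with
  | empty =>
    obtain ⟨α, -, hα⟩ := ht (Classical.arbitrary _)
    simpa [← hα] using hsne α
  | insert α u hlt ih =>
    have hα : s α = t := hu (by simp)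
    have ih := ih fun β hβ => hu (by simp [Finset.mem_coe.1 hβ])
    let w : Set (Set Y) := (fun β => (Q β).1 (ε β)) '' u
    have hw : ⋂₀ (t ∪ w) = ⋂₀ t ∩ ⋂ β ∈ u, (Q β).1 (ε β) := by
      rw [sInter_union, sInter_image]; rfl
    have := hst α (t ∪ w)
      (union_subset (hα ▸ hs α) (by rintro _ ⟨β, hβ, rfl⟩; exact ⟨β, hlt β hβ, ε β, rfl⟩))
      ((hα ▸ hsf α).union (u.finite_toSet.image _)) (hα ▸ subset_union_left) (hw ▸ ih) (ε α)
    rw [hw, inter_assoc] at this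
    rw [Finset.set_biInter_insert, inter_comm ((Q α).1 (ε α))]
    exact this

/-- Countably many functions suffice to realize all finite patterns. -/
theorem exists_countable_independent_family :
    ∃ 𝓒 : Set (CountableOrdinal → Bool), 𝓒.Countable ∧
      ∀ (u : Finset CountableOrdinal) (η : CountableOrdinal → Bool), ∃ c ∈ 𝓒, ∀ α ∈ u, c α = η α := by
  classical
  obtain ⟨j, hj⟩ := exists_injective_real
  obtain ⟨b, hbc, -, hb⟩ := TopologicalSpace.exists_countable_basis ℝ
  -- This is separability of `2^ω₁`, witnessed by traces of finite unions of basic open sets of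
  -- reals.
  refine ⟨(fun t : Set (Set ℝ) => fun α => decide (j α ∈ ⋃₀ t)) '' {t | t.Finite ∧ t ⊆ b},
    (countable_ofPred_finite_subset hbc).image _, fun u η => ?_⟩
  have hB : ∀ α, ∃ B ∈ b, j α ∈ B ∧ ∀ β ∈ u, j β ∈ B → β = α := by
    intro α
    obtain ⟨B, hB, hαB, hBs⟩ := hb.exists_subset_of_mem_open
      (a := j α) (u := (j '' (u.erase α : Set CountableOrdinal))ᶜ)
      (by
        rintro ⟨β, hβ, h⟩
        exact Finset.ne_of_mem_erase (Finset.mem_coe.1 hβ) (hj h))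
      ((u.erase α).finite_toSet.image j).isClosed.isOpen_compl
    refine ⟨B, hB, hαB, fun β hβ hβB => ?_⟩
    by_contra hne
    exact hBs hβB ⟨β, Finset.mem_coe.2 (Finset.mem_erase.2 ⟨hne, hβ⟩), rfl⟩
  choose B hBb hBα hBu using hB
  refine ⟨_, ⟨B '' {α | α ∈ u ∧ η α = true},
    ⟨(u.finite_toSet.subset fun α hα => hα.1).image B, ?_⟩, rfl⟩, fun α hα => ?_⟩
  · rintro _ ⟨α, -, rfl⟩
    exact hBb α
  · have key : j α ∈ ⋃₀ (B '' {α | α ∈ u ∧ η α = true}) ↔ η α = true := by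
      refine ⟨?_, fun h => ⟨B α, ⟨α, ⟨hα, h⟩, rfl⟩, hBα α⟩⟩
      rintro ⟨_, ⟨β, ⟨-, hβη⟩, rfl⟩, hαβ⟩
      rwa [hBu β α hα hαβ]
    change decide _ = _
    simp only [key, Bool.decide_eq_true]

/-- A special case of Šapirovskii's theorem. -/
theorem exists_hasCountablePiBaseAt {Y : Type*} [TopologicalSpace Y] [CompactSpace Y] [T2Space Y]
    [Nonempty Y] (hfc : ∀ A : Set Y, A.Countable → FirstCountableTopology (closure A)) :
    ∃ p : Y, HasCountablePiBaseAt p := by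
  by_contra! hno
  obtain ⟨Q, S, hS, hdisj, hQ⟩ := exists_dyadic_system hno
  obtain ⟨𝓒, h𝓒, h𝓒u⟩ := exists_countable_independent_family
  have hpt : ∀ ε : CountableOrdinal → Bool, ∃ y, ∀ α ∈ S, y ∈ closure (Q α (ε α)) := by
    intro ε
    obtain ⟨y, hy⟩ := CompactSpace.iInter_nonempty (t := fun α : S => closure (Q α (ε α)))
      (fun _ => isClosed_closure) (fun u => by
        refine (hQ (u.map (Function.Embedding.subtype _)) ε (by
          intro α hα; simp at hα; exact hα.1)).mono fun y hy => ?_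
        simp only [Finset.mem_map, mem_iInter] at hy ⊢
        exact fun α hα => subset_closure (hy α ⟨α, hα, rfl⟩))
    exact ⟨y, fun α hα => mem_iInter.1 hy ⟨α, hα⟩⟩
  choose d hd using hpt
  let A := d '' 𝓒
  have hAc : A.Countable := h𝓒.image d
  have := hfc A hAc
  have hCpt : ∀ η : CountableOrdinal → Bool,
      ∃ y ∈ closure A, ∀ α ∈ S, y ∈ closure (Q α (η α)) := by
    intro η
    obtain ⟨y, hyA, hy⟩ := isClosed_closure.isCompact.inter_iInter_nonempty
      (s := closure A) (fun α : S => closure (Q α (η α)))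
      (fun _ => isClosed_closure) (fun u => by
        obtain ⟨c, hc, hcu⟩ := h𝓒u (u.map (Function.Embedding.subtype _)) η
        refine ⟨d c, subset_closure (mem_image_of_mem d hc), ?_⟩
        simp only [mem_iInter]
        intro α hα
        rw [← hcu α (by simpa using hα)]
        exact hd c α α.2)
    exact ⟨y, hyA, fun α hα => mem_iInter.1 hy ⟨α, hα⟩⟩
  -- `T` is sequentially closed since countably many thresholds `γ` have a common bound; first
  -- countability makes it closed. A point of `T` on the `true` side at every index of `S` is then
  -- impossible, yet compactness provides one.
  let T : Set Y := {y | y ∈ closure A ∧ ∃ γ, ∀ α ∈ S, γ ≤ α → y ∈ closure (Q α false)}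
  have hT : IsClosed T := by
    refine isClosed_of_closure_subset fun y hy => ?_
    have hyA : y ∈ closure A := closure_minimal (fun _ h => h.1) isClosed_closure hy
    have hy' : (⟨y, hyA⟩ : closure A) ∈ closure ((↑) ⁻¹' T : Set (closure A)) := by
      rw [closure_subtype, Subtype.image_preimage_coe]
      rwa [inter_eq_right.2 (show T ⊆ closure A from fun _ h => h.1)]
    obtain ⟨x, hx, hxy⟩ := mem_closure_iff_seq_limit.1 hy'
    choose γ hγ using fun n => (hx n).2
    obtain ⟨γ', hγ'⟩ := exists_gt (countable_range γ)
    refine ⟨hyA, γ', fun α hα h => ?_⟩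
    exact isClosed_closure.mem_of_tendsto ((continuous_subtype_val.tendsto _).comp hxy)
      (Eventually.of_forall fun n => hγ n α hα ((hγ' _ (mem_range_self n)).le.trans h))
  let D : CountableOrdinal → Set Y := fun γ => {y | y ∈ T ∧ ∀ α ∈ S, α < γ → y ∈ closure (Q α true)}
  have hDc : ∀ γ, IsClosed (D γ) := fun γ => by
    have : D γ = T ∩ ⋂ α ∈ S, ⋂ (_ : α < γ), closure (Q α true) := by ext; simp [D]
    rw [this]
    exact hT.inter (isClosed_biInter fun α _ => isClosed_iInter fun _ => isClosed_closure)
  have hDa : Antitone D := fun γ γ' h y hy => ⟨hy.1, fun α hα hαγ => hy.2 α hα (hαγ.trans_le h)⟩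
  have hDn : ∀ γ, (D γ).Nonempty := fun γ => by
    classical
    obtain ⟨y, hyA, hy⟩ := hCpt fun α => decide (α < γ)
    refine ⟨y, ⟨hyA, γ, fun α hα h => ?_⟩, fun α hα h => ?_⟩
    · simpa [not_lt.2 h] using hy α hα
    · simpa [h] using hy α hα
  obtain ⟨y, hy⟩ := IsCompact.nonempty_iInter_of_directed_nonempty_isCompact_isClosed D
    hDa.directed_ge hDn (fun γ => (hDc γ).isCompact) hDc
  rw [mem_iInter] at hy
  obtain ⟨⟨-, γ, hγ⟩, -⟩ := hy (Classical.arbitrary _)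
  obtain ⟨α, hα, hγα⟩ := hS γ
  obtain ⟨γ', hγ'⟩ := exists_gt (countable_singleton α)
  exact disjoint_left.1 (hdisj α) (hγ α hα hγα) ((hy γ').2 α hα (hγ' α rfl))

/-! ### Free sequences and convergence -/

/-- A free sequence indexed by the countable ordinals, in a compact space whose separable closed
sets are first countable, yields a converging `ω₁`-sequence. -/
theorem not_omegaOneFree_of_free_sequence {X : Type*} [TopologicalSpace X] [CompactSpace X]
    [T2Space X] (hfc : ∀ A : Set X, A.Countable → FirstCountableTopology (closure A))
    {z : CountableOrdinal → X}
    (hz : ∀ α, Disjoint (closure (z '' Iio α)) (closure (z '' Ici α))) : ¬ OmegaOneFree X := by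
  let E : CountableOrdinal → Set X := fun α => closure (z '' Ici α)
  have hEa : Antitone E := fun α β h => closure_mono (image_mono (Ici_subset_Ici.2 h))
  have hEc : ∀ α, IsClosed (E α) := fun _ => isClosed_closure
  let F : Set X := ⋂ α, E α
  have hFc : IsClosed F := isClosed_iInter hEc
  have hFn : Nonempty F := (IsCompact.nonempty_iInter_of_directed_nonempty_isCompact_isClosed E
    hEa.directed_ge (fun α => ⟨z α, subset_closure ⟨α, self_mem_Ici, rfl⟩⟩)
    (fun α => (hEc α).isCompact) hEc).to_subtype
  have : CompactSpace F := isCompact_iff_compactSpace.1 hFc.isCompact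
  obtain ⟨p, 𝓑, h𝓑c, h𝓑o, h𝓑p⟩ := exists_hasCountablePiBaseAt (Y := F) (by
    intro A hA
    have := hfc (Subtype.val '' A) (hA.image _)
    have hmaps : ∀ x : closure A, (x : F).1 ∈ closure (Subtype.val '' A : Set X) := fun x =>
      image_closure_subset_closure_image continuous_subtype_val ⟨x, x.2, rfl⟩
    have hval : IsInducing fun x : closure A => (x : F).1 :=
      IsInducing.subtypeVal.comp IsInducing.subtypeVal
    have hind : IsInducing fun x : closure A =>
        (⟨(x : F).1, hmaps x⟩ : closure (Subtype.val '' A : Set X)) :=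
      hval.of_comp (hval.continuous.subtype_mk _) continuous_subtype_val
    exact hind.firstCountableTopology)
  have := h𝓑c.to_subtype
  have hO : ∀ B : 𝓑, ∃ O : Set X, IsOpen O ∧ (O ∩ F).Nonempty ∧
      ∀ y ∈ closure O, ∀ h : y ∈ F, (⟨y, h⟩ : F) ∈ B.1 := by
    rintro ⟨B, hB⟩
    obtain ⟨G, hG, rfl⟩ := isOpen_induced_iff.1 (h𝓑o B hB).1
    obtain ⟨y, hy⟩ := (h𝓑o _ hB).2
    obtain ⟨C, hC, hCc, hCG⟩ := exists_mem_nhds_isClosed_subset (hG.mem_nhds hy)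
    exact ⟨interior C, isOpen_interior, ⟨y, mem_interior_iff_mem_nhds.2 hC, y.2⟩,
      fun y hy _ => hCG (closure_minimal interior_subset hCc hy)⟩
  choose O hOo hOF hOB using hO
  -- The sets `N U` generate a filter on the π-base; an ultrafilter above it picks one limit for
  -- each `α`.
  let N : Set X → Set 𝓑 := fun U => {B | ∃ α, O B ∩ E α ⊆ U}
  have hN : ∀ U ∈ 𝓝 p.1, (N U).Nonempty := by
    intro U hU
    obtain ⟨B, hB, hBU⟩ := h𝓑p (Subtype.val ⁻¹' interior U)
      (continuous_subtype_val.continuousAt.preimage_mem_nhds (interior_mem_nhds.2 hU))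
    obtain ⟨α, hα⟩ := exists_subset_nhds_of_compactSpace (V := fun α => closure (O ⟨B, hB⟩) ∩ E α)
      (U := U) (Antitone.directed_ge fun α β h => inter_subset_inter_right _ (hEa h))
      (fun α => isClosed_closure.inter (hEc α)) (fun y hy => by
        rw [mem_iInter] at hy
        have hyF : y ∈ F := mem_iInter.2 fun α => (hy α).2
        exact mem_interior_iff_mem_nhds.1
          (hBU (hOB ⟨B, hB⟩ y (hy (Classical.arbitrary _)).1 hyF)))
    exact ⟨⟨B, hB⟩, α, (inter_subset_inter_left _ subset_closure).trans hα⟩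
  have hNmono : ∀ U V, U ⊆ V → N U ⊆ N V := fun U V h B ⟨α, hα⟩ => ⟨α, hα.trans h⟩
  have hNfil : ((𝓝 p.1).lift' N).NeBot := by
    rw [lift'_neBot_iff (fun U V h => hNmono U V h)]
    exact hN
  obtain ⟨𝓤, h𝓤⟩ := Ultrafilter.exists_le ((𝓝 p.1).lift' N)
  have hzO : ∀ α, ∀ B : 𝓑, ∃ β, α ≤ β ∧ z β ∈ O B := by
    intro α B
    obtain ⟨y, hyO, hyF⟩ := hOF B
    obtain ⟨_, hw, β, hβ, rfl⟩ := mem_closure_iff.1 (mem_iInter.1 hyF α) (O B) (hOo B) hyO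
    exact ⟨β, hβ, hw⟩
  choose b hb hbO using hzO
  let y : CountableOrdinal → X := fun α => (𝓤.map fun B => z (b α B)).lim
  have hy : ∀ α, Tendsto (fun B => z (b α B)) 𝓤 (𝓝 (y α)) := fun α =>
    Ultrafilter.le_nhds_lim (𝓤.map fun B => z (b α B))
  refine not_omegaOneFree_of_tendsto (s := y) (p := p.1) (fun α h => ?_) fun U hU => ?_
  · obtain ⟨γ, hγ⟩ := exists_gt (countable_range (b α))
    -- `𝓑` is countable, so `y α` is a limit of an initial segment; freeness keeps it out of `F`.
    have h₁ : y α ∈ closure (z '' Iio γ) := mem_closure_of_tendsto (hy α)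
      (Eventually.of_forall fun B => mem_image_of_mem z (hγ _ (mem_range_self B)))
    exact disjoint_left.1 (hz γ) h₁ (h ▸ mem_iInter.1 p.2 γ)
  · obtain ⟨C, hC, hCc, hCU⟩ := exists_mem_nhds_isClosed_subset hU
    have hC𝓤 : N C ∈ 𝓤 := h𝓤 (mem_lift' hC)
    have : ∀ B : 𝓑, ∃ α, B ∈ N C → O B ∩ E α ⊆ C := fun B => by
      by_cases hB : B ∈ N C
      · obtain ⟨α, hα⟩ := hB
        exact ⟨α, fun _ => hα⟩
      · exact ⟨Classical.arbitrary _, fun h => (hB h).elim⟩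
    choose a ha using this
    -- One tail serves all of the countably many `B`.
    obtain ⟨γ, hγ⟩ := exists_gt (countable_range a)
    refine ⟨γ, fun β hβ => hCU (hCc.mem_of_tendsto (hy β) ?_)⟩
    filter_upwards [hC𝓤] with B hB
    exact ha B hB ⟨hbO β B, subset_closure ⟨_, ((hγ _ (mem_range_self B)).le.trans hβ).trans
      (hb β B), rfl⟩⟩

/-- In an `ω₁`-free compact space whose separable closed sets are first countable, a set that
contains the closures of its countable subsets is closed. -/
theorem OmegaOneFree.isClosed_of_closure_countable_subset {X : Type*} [TopologicalSpace X]
    [CompactSpace X] [T2Space X] (hfree : OmegaOneFree X)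
    (hfc : ∀ A : Set X, A.Countable → FirstCountableTopology (closure A))
    {T : Set X} (hT : ∀ A ⊆ T, A.Countable → closure A ⊆ T) : IsClosed T := by
  refine isClosed_of_closure_subset fun y hy => ?_
  by_contra hyT
  have hZ : ∀ A : Set X, ∃ Z : Set X, IsClosed Z ∧ IsGδ Z ∧ y ∈ Z ∧
      (A ⊆ T → A.Countable → Disjoint Z (closure A)) := by
    intro A
    by_cases hA : A ⊆ T ∧ A.Countable
    · obtain ⟨Z, hZA, hZ⟩ := (isClosed_closure (s := A)).isOpen_compl.isGδ.exists_isClosed_isGδ_subset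
        (y := y) fun h => hyT (hT A hA.1 hA.2 h)
      exact ⟨Z, hZ.1, hZ.2.1, hZ.2.2, fun _ _ => disjoint_left.2 fun _ h h' => hZA h h'⟩
    · exact ⟨univ, isClosed_univ, .univ, mem_univ y, fun h h' => (hA ⟨h, h'⟩).elim⟩
  choose Z hZc hZG hyZ hZd using hZ
  obtain ⟨z, hz⟩ := exists_recursive_sequence
    -- Allowing `β = α` places the whole tail from `α` on in the set `Z` that avoids the closure of
    -- the segment below `α`.
    (fun α (f : ∀ β, β < α → X) x => x ∈ T ∧
      ∀ β (h : β ≤ α), x ∈ Z {w | ∃ γ, ∃ h' : γ < β, f γ (h'.trans_le h) = w}) (by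
      intro α f
      have := (countable_Iic α).to_subtype
      obtain ⟨x, hx, hxT⟩ := IsGδ.inter_nonempty_of_mem_closure hT hy
        (G := ⋂ β : Set.Iic α, Z {w | ∃ γ, ∃ h' : γ < β.1, f γ (h'.trans_le β.2) = w})
        (.iInter fun β => hZG _) (mem_iInter.2 fun β => hyZ _)
      exact ⟨x, hxT, fun β h => mem_iInter.1 hx ⟨β, h⟩⟩)
  have hset : ∀ β, {w | ∃ γ, ∃ _ : γ < β, z γ = w} = z '' Iio β := fun β => by
    ext; simp
  simp only [hset] at hz
  refine not_omegaOneFree_of_free_sequence hfc (z := z) (fun α => ?_) hfree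
  have h₁ : closure (z '' Ici α) ⊆ Z (z '' Iio α) := closure_minimal
    (by rintro _ ⟨β, hβ, rfl⟩; exact (hz β).2 α hβ) (hZc _)
  exact ((hZd _ (by rintro _ ⟨β, -, rfl⟩; exact (hz β).1)
    ((countable_Iio α).image z)).mono_left h₁).symm

/-! ### First countability of the whole space -/

theorem mainTheorem3 {X : Type*} [TopologicalSpace X] [CompactSpace X] [T2Space X]
    (hfree : OmegaOneFree X)
    (hsep : ∀ S : Set X, TopologicalSpace.SeparableSpace S → FirstCountableTopology S) :
    FirstCountableTopology X := by
  have hfc : ∀ A : Set X, A.Countable → FirstCountableTopology (closure A) :=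
    fun A hA => hsep _ hA.separableSpace_closure
  refine ⟨fun x => ?_⟩
  by_contra hx
  have hxG : ¬ IsGδ {x} := fun h => hx h.isCountablyGenerated_nhds
  have hZ : ∀ A : Set X, ∃ Z : Set X, IsClosed Z ∧ IsGδ Z ∧ x ∈ Z ∧
      (A.Countable → Z ∩ closure A ⊆ {x}) := by
    intro A
    by_cases hA : A.Countable
    · have := hfc _ (hA.insert x)
      have hxA : x ∈ closure (insert x A) := subset_closure (mem_insert x A)
      have hG : IsGδ {(⟨x, hxA⟩ : closure (insert x A))} := .singleton _
      obtain ⟨U, hU, hUx⟩ := isGδ_iff_eq_iInter_nat.1 hG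
      choose V hV hVU using fun n => isOpen_induced_iff.1 (hU n)
      have hVx : ∀ w (hw : w ∈ closure (insert x A)), w ∈ ⋂ n, V n ↔ w = x := by
        intro w hw
        have : (⟨w, hw⟩ : closure (insert x A)) ∈ ⋂ n, U n ↔ w = x := by
          rw [← hUx]; simp
        simpa [← hVU] using this
      obtain ⟨Z, hZV, hZ⟩ := (IsGδ.iInter_of_isOpen hV).exists_isClosed_isGδ_subset
        ((hVx x hxA).2 rfl)
      exact ⟨Z, hZ.1, hZ.2.1, hZ.2.2, fun _ w hw =>
        (hVx w (closure_mono (subset_insert x A) hw.2)).1 (hZV hw.1)⟩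
    · exact ⟨univ, isClosed_univ, .univ, mem_univ x, fun h => (hA h).elim⟩
  choose Z hZc hZG hxZ hZA using hZ
  obtain ⟨s, hs⟩ := exists_recursive_sequence
    (fun α (f : ∀ β, β < α → X) y => y ≠ x ∧
      ∀ β (h : β ≤ α), y ∈ Z {w | ∃ γ, ∃ h' : γ < β, f γ (h'.trans_le h) = w}) (by
      intro α f
      have := (countable_Iic α).to_subtype
      -- Otherwise `{x}` would be a countable intersection of Gδ sets.
      by_contra! hcon
      refine hxG ?_
      have : {x} = ⋂ β : Set.Iic α, Z {w | ∃ γ, ∃ h' : γ < β.1, f γ (h'.trans_le β.2) = w} := by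
        refine subset_antisymm (singleton_subset_iff.2 (mem_iInter.2 fun β => hxZ _)) fun y hy => ?_
        by_contra hyx
        obtain ⟨β, h, hβ⟩ := hcon y hyx
        exact hβ (mem_iInter.1 hy ⟨β, h⟩)
      rw [this]
      exact .iInter fun β => hZG _)
  have hset : ∀ β, {w | ∃ γ, ∃ _ : γ < β, s γ = w} = s '' Iio β := fun β => by
    ext; simp
  simp only [hset] at hs
  let T : Set X := ⋃ α, closure (s '' Iio α)
  have hmono : Monotone fun α => closure (s '' Iio α) := fun α β h =>
    closure_mono (image_mono (Iio_subset_Iio h))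
  have hTc : IsClosed T := hfree.isClosed_of_closure_countable_subset hfc fun A hA hAc => by
    -- A countable subset of `T` lies in a single closure of the increasing union.
    choose! g hg using fun w (hw : w ∈ A) => mem_iUnion.1 (hA hw)
    obtain ⟨γ, hγ⟩ := exists_gt (hAc.image g)
    exact (closure_minimal (fun w hw => hmono (hγ _ (mem_image_of_mem g hw)).le (hg w hw))
      isClosed_closure).trans (subset_iUnion (fun α => closure (s '' Iio α)) γ)
  let D : CountableOrdinal → Set X := fun α => T ∩ ⋂ β ∈ Iic α, Z (s '' Iio β)
  refine not_omegaOneFree_of_tendsto (s := s) (p := x) (fun α => (hs α).1) (fun U hU => ?_) hfree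
  -- The closed sets `D α` decrease to a subset of `{x}`, so one of them lies in `U`; it contains a
  -- tail of `s`.
  obtain ⟨α, hα⟩ := exists_subset_nhds_of_compactSpace (V := D) (U := U)
    (Antitone.directed_ge fun α β h =>
      inter_subset_inter_right _ (biInter_subset_biInter_left (Iic_subset_Iic.2 h)))
    (fun α => hTc.inter (isClosed_biInter fun β _ => hZc _)) (fun w hw => by
      rw [mem_iInter] at hw
      obtain ⟨γ, hγ⟩ := mem_iUnion.1 (hw (Classical.arbitrary _)).1
      have hwx : w = x := hZA _ ((countable_Iio γ).image s)
        ⟨mem_iInter₂.1 (hw γ).2 γ self_mem_Iic, hγ⟩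
      rwa [hwx])
  refine ⟨α, fun β hβ => hα ⟨?_, mem_iInter₂.2 fun γ hγ => (hs β).2 γ (le_trans hγ hβ)⟩⟩
  obtain ⟨γ, hγ⟩ := exists_gt (countable_singleton β)
  exact mem_iUnion.2 ⟨γ, subset_closure ⟨β, hγ β rfl, rfl⟩⟩
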